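/- Let $\mathsf D$ be a (locally small, not necessarily small) category with a coverage: every object $D$ is assigned a collection of covering families $(f_i\colon D_i\to D)_{i\in I}$ such that for each covering family $(f_i)$ of $D$ and each morphism $g\colon C\to D$ there is a covering family $(h_j\colon C_j\to C)_{j\in J}$ such that every $g h_j$ factors through some $f_i$. A presheaf $X\colon\mathsf D^{\mathrm{op}}\to\mathrm{Set}$ is a sheaf if for every covering family $(f_i\colon D_i\to D)_{i\in I}$ and every family $\varphi_i\in X(D_i)$ such that $X(g)(\varphi_i)=X(h)(\varphi_j)$ whenever $f_i g=f_j h$, there is a unique $\varphi\in X(D)$ with $X(f_i)(\varphi)=\varphi_i$ for all $i$. Assume that $\mathsf D$ is a concrete site, that is: every representable presheaf on $\mathsf D$ is a sheaf; $\mathsf D$ has a terminal object $1$; the functor $\hom(1,-)\colon\mathsf D\to\mathrm{Set}$ is faithful; and for each covering family $(f_i\colon D_i\to D)_{i\in I}$ the functions $\hom(1,f_i)\colon\hom(1,D_i)\to\hom(1,D)$ are jointly surjective. Call a sheaf $X$ on $\mathsf D$ concrete if for every object $D$ the map $X(D)\to X(1)^{\hom(1,D)}$, $\varphi\mapsto\bigl(d\mapsto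 X(d)(\varphi)\bigr)$, is injective, and let $\mathsf D\mathrm{Space}$ be the category of concrete sheaves on $\mathsf D$ and natural transformations. Then $\mathsf D\mathrm{Space}$ has all small limits and all small colimits, and it is a quasitopos, that is: (1) it is locally cartesian closed: for every object $B$, the slice category over $B$ has finite products and for each of its objects $Y$ the functor $-\times Y$ has a right adjoint; (2) it has finite limits and finite colimits; (3) it has a weak subobject classifier: there are an object $\Omega$ and a morphism $\top\colon 1\to\Omega$ from the terminal object such that for every strong monomorphism $i\colon A\to X$ there is a unique morphism $\chi\colon X\to\Omega$ for which the square formed by $i$, $A\to 1$, $\chi$ and $\top$ is a pullback. Here a monomorphism $i$ is strong if for every epimorphism $p\colon E\to B$ and all morphisms $f\colon E\to A$, $g\colon B\to X$ with $if=gp$ there is a unique $t\colon B\to A$ with $tp=f$ and $it=g$. -/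

import Mathlib

open CategoryTheory CategoryTheory.Limits Opposite

universe v u v' u'

namespace GeneralizedSpaces

section Sites

variable {D : Type u} [Category.{v} D]

/-- A presheaf of sets is a sheaf for a coverage if, for every covering family, every compatible
collection of plots has a unique amalgamation. -/
def IsSheaf (K : Coverage D) (X : Dᵒᵖ ⥤ Type v) : Prop :=
  ∀ ⦃U : D⦄, ∀ R ∈ K.coverings U, Presieve.IsSheafFor X R

/-- A site is subcanonical if every representable presheaf is a sheaf. -/
def IsSubcanonical (K : Coverage D) : Prop :=
  ∀ X : Dᵒᵖ ⥤ Type v, X.IsRepresentable → IsSheaf K X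

variable [HasTerminal D]

/-- Concrete sites: subcanonical sites with a terminal object `1` such that `hom(1,-)` is faithful
and covering families are jointly surjective on points. -/
structure IsConcreteSite (K : Coverage D) : Prop where
  subcanonical : IsSubcanonical K
  faithful : (coyoneda.obj (op (⊤_ D))).Faithful
  jointly_surjective : ∀ ⦃U : D⦄, ∀ R ∈ K.coverings U, ∀ p : ⊤_ D ⟶ U,
    ∃ (V : D) (f : V ⟶ U), R f ∧ ∃ q : ⊤_ D ⟶ V, q ≫ f = p

/-- The underlying function `hom(1,U) → X(1)` of a plot `φ ∈ X(U)`. -/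
noncomputable def underlying (X : Dᵒᵖ ⥤ Type v) {U : D} (φ : X.obj (op U)) :
    (⊤_ D ⟶ U) → X.obj (op (⊤_ D)) :=
  fun d => X.map d.op φ

/-- A presheaf is concrete if its plots are determined by their underlying functions. -/
def IsConcrete (X : Dᵒᵖ ⥤ Type v) : Prop :=
  ∀ U : D, Function.Injective (fun φ : X.obj (op U) => underlying X φ)

/-- The property of being a concrete sheaf. -/
def isConcreteSheaf (K : Coverage D) : ObjectProperty (Dᵒᵖ ⥤ Type v) :=
  fun X => IsSheaf K X ∧ IsConcrete X

/-- The category of concrete sheaves on a site, with natural transformations as morphisms. -/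
abbrev DSpace (K : Coverage D) := (isConcreteSheaf K).FullSubcategory

end Sites

section Quasitopos

variable (C : Type u') [Category.{v'} C]

/-- A category is cartesian closed if it has finite products and every functor `- ⨯ Y` has a
right adjoint. -/
def IsCartesianClosed : Prop :=
  ∃ _ : HasFiniteProducts C, ∀ Y : C, (prod.functor.flip.obj Y).IsLeftAdjoint

/-- A category is locally cartesian closed if all its slices are cartesian closed. -/
def IsLocallyCartesianClosed : Prop :=
  ∀ B : C, IsCartesianClosed (Over B)

/-- A weak subobject classifier in a category with finite limits: a morphism `1 ⟶ Ω` such that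
every strong monomorphism is the pullback of it along a unique morphism. -/
def HasWeakSubobjectClassifier [HasFiniteLimits C] : Prop :=
  ∃ (Ω : C) (t : ⊤_ C ⟶ Ω), ∀ ⦃A X : C⦄ (i : A ⟶ X), StrongMono i →
    ∃! χ : X ⟶ Ω, IsPullback i (terminal.from A) χ t

/-- Quasitoposes. -/
structure IsQuasitopos : Prop where
  locallyCartesianClosed : IsLocallyCartesianClosed C
  hasFiniteLimits : HasFiniteLimits C
  hasFiniteColimits : HasFiniteColimits C
  hasWeakSubobjectClassifier : HasWeakSubobjectClassifier C

end Quasitopos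

end GeneralizedSpaces

/-! A concrete sheaf `X` is determined by the set `X(1)` together with the functions `hom(1,U) →
X(1)` that underlie its plots. So `DSpace K` is equivalent to the category of sets with a plot
structure (`isEquivalence_toDSpace`), and joint surjectivity of covers is needed only there.

Plot structures can be pulled back along functions (`initial`) and generated by them (`final`), so
limits and colimits are those of sets. Exponentials over `B` are sets of plot-preserving maps
between fibres. Strong monomorphisms are subspace inclusions, classified by the codiscrete space of
truth values, to which every function is a morphism. All of this is transported along the
equivalence. -/

namespace GeneralizedSpaces

/-! ### Sets with plots, their limits and colimits -/

section PlotSpaces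

variable {D : Type u} [Category.{v} D] [HasTerminal D]

/-- A plot structure on a set `S`: a collection of functions `hom(1,U) → S` that contains every
point, is stable under precomposition, and is local for the coverage. -/
structure PlotStructure (K : Coverage D) (S : Type v) where
  /-- The functions that are plots. -/
  IsPlot : ∀ {U : D}, ((⊤_ D ⟶ U) → S) → Prop
  point : ∀ f : (⊤_ D ⟶ ⊤_ D) → S, IsPlot f
  comp : ∀ {U V : D} {f : (⊤_ D ⟶ U) → S} (_ : IsPlot f) (g : V ⟶ U),
    IsPlot (fun d => f (d ≫ g))
  glue : ∀ {U : D} (R : Presieve U) (_ : R ∈ K.coverings U) (f : (⊤_ D ⟶ U) → S)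
    (_ : ∀ (V : D) (g : V ⟶ U), R g → IsPlot (fun d => f (d ≫ g))), IsPlot f

/-- A set with a plot structure. -/
structure PlotSpace (K : Coverage D) where
  /-- The underlying set. -/
  carrier : Type v
  /-- The plots. -/
  plots : PlotStructure K carrier

variable {K : Coverage D}

namespace PlotSpace

/-- The functions `hom(1,U) → S` that are plots of a plot space. -/
abbrev IsPlot (S : PlotSpace K) {U : D} (f : (⊤_ D ⟶ U) → S.carrier) : Prop := S.plots.IsPlot f

lemma isPlot_const (S : PlotSpace K) (U : D) (s : S.carrier) :
    S.IsPlot (fun _ : ⊤_ D ⟶ U => s) :=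
  S.plots.comp (S.plots.point fun _ => s) (terminal.from U)

/-- A morphism of plot spaces is a function that preserves plots. -/
@[ext]
structure Hom (S T : PlotSpace K) where
  /-- The underlying function. -/
  toFun : S.carrier → T.carrier
  map_plot : ∀ {U : D} {f : (⊤_ D ⟶ U) → S.carrier}, S.IsPlot f → T.IsPlot (fun d => toFun (f d))

instance : Category (PlotSpace K) where
  Hom := Hom
  id S := ⟨fun x => x, fun h => h⟩
  comp f g := ⟨fun x => g.toFun (f.toFun x), fun h => g.map_plot (f.map_plot h)⟩

@[simp] lemma comp_toFun {S T W : PlotSpace K} (f : S ⟶ T) (g : T ⟶ W) (x : S.carrier) :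
    (f ≫ g).toFun x = g.toFun (f.toFun x) := rfl

lemma hom_ext {S T : PlotSpace K} {f g : S ⟶ T} (h : ∀ x, f.toFun x = g.toFun x) : f = g :=
  Hom.ext (funext h)

lemma congr_toFun {S T : PlotSpace K} {f g : S ⟶ T} (h : f = g) (x : S.carrier) :
    f.toFun x = g.toFun x := h ▸ rfl

/-- The underlying set of a plot space. -/
@[simps]
def forget (K : Coverage D) : PlotSpace K ⥤ Type v where
  obj S := S.carrier
  map f := ↾f.toFun

end PlotSpace

namespace PlotStructure

/-- The initial plot structure for a family of functions to plot spaces. -/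
@[simps]
def initial {ι : Type*} (T : ι → PlotSpace K) {S : Type v} (p : ∀ i, S → (T i).carrier) :
    PlotStructure K S where
  IsPlot f := ∀ i, (T i).IsPlot (fun d => p i (f d))
  point _ i := (T i).plots.point _
  comp h g i := (T i).plots.comp (h i) g
  glue R hR _ h i := (T i).plots.glue R hR _ fun V g hg => h V g hg i

/-- The functions generated from a family of functions out of plot spaces. -/
inductive Generated {ι : Type*} (T : ι → PlotSpace K) {S : Type v}
    (p : ∀ i, (T i).carrier → S) : ∀ {U : D}, ((⊤_ D ⟶ U) → S) → Prop
  -- The precomposition with `g` is built in so that the clause is stable under pullback.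
  | point (f : (⊤_ D ⟶ ⊤_ D) → S) (U : D) (g : U ⟶ ⊤_ D) : Generated T p (fun d => f (d ≫ g))
  | of (i : ι) {U : D} (f : (⊤_ D ⟶ U) → (T i).carrier) (hf : (T i).IsPlot f) :
      Generated T p (fun d => p i (f d))
  | glue {U : D} (R : Presieve U) (_ : R ∈ K.coverings U) (f : (⊤_ D ⟶ U) → S)
      (_ : ∀ (V : D) (g : V ⟶ U), R g → Generated T p (fun d => f (d ≫ g))) : Generated T p f

/-- In the gluing case the coverage axiom refines the pulled-back cover so that each member factors
through a member of `R`, where the induction hypothesis applies. -/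
lemma Generated.comp {ι : Type*} {T : ι → PlotSpace K} {S : Type v}
    {p : ∀ i, (T i).carrier → S} {U : D} {f : (⊤_ D ⟶ U) → S} (h : Generated T p f) :
    ∀ {V : D} (g : V ⟶ U), Generated T p (fun d => f (d ≫ g)) := by
  induction h with
  | point f _ k =>
    intro V g
    simpa only [Category.assoc] using Generated.point (T := T) (p := p) f V (g ≫ k)
  | of i _ hf => exact fun g => .of i _ ((T i).plots.comp hf g)
  | glue R hR _ _ ih =>
    intro V g
    obtain ⟨R', hR', hfac⟩ := K.pullback g R hR
    refine .glue R' hR' _ fun W h hh => ?_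
    obtain ⟨Z, i, e, he, hcomm⟩ := hfac hh
    simpa only [Category.assoc, hcomm] using ih Z e he i

/-- The final plot structure for a family of functions out of plot spaces. -/
@[simps]
def final {ι : Type*} (T : ι → PlotSpace K) {S : Type v} (p : ∀ i, (T i).carrier → S) :
    PlotStructure K S where
  IsPlot f := Generated T p f
  point f := by simpa using Generated.point (T := T) (p := p) f _ (𝟙 _)
  comp h g := h.comp g
  glue R hR f h := .glue R hR f h

lemma Generated.map {ι : Type*} {T : ι → PlotSpace K} {S : Type v}
    {p : ∀ i, (T i).carrier → S} {W : PlotSpace K} {q : S → W.carrier}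
    (hq : ∀ (i : ι) {U : D} (f : (⊤_ D ⟶ U) → (T i).carrier), (T i).IsPlot f →
      W.IsPlot (fun d => q (p i (f d))))
    {U : D} {f : (⊤_ D ⟶ U) → S} (h : Generated T p f) : W.IsPlot (fun d => q (f d)) := by
  induction h with
  | point f _ k => exact W.plots.comp (W.plots.point fun d => q (f d)) k
  | of i f hf => exact hq i f hf
  | glue R hR _ _ ih => exact W.plots.glue R hR _ ih

end PlotStructure

namespace PlotSpace

section Limits

variable {J : Type*} [Category* J] (F : J ⥤ PlotSpace K)

/-- A limit cone of underlying sets, with the initial plot structure. -/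
@[simps]
def liftCone (c : Cone (F ⋙ forget K)) : Cone F where
  pt := ⟨c.pt, .initial F.obj fun j => c.π.app j⟩
  π :=
    { app j := ⟨c.π.app j, fun h => h j⟩
      naturality _ _ f := hom_ext fun x => ConcreteCategory.congr_hom (c.π.naturality f) x }

/-- The cone `liftCone F c` is a limit cone if `c` is. -/
def isLimitLiftCone {c : Cone (F ⋙ forget K)} (hc : IsLimit c) : IsLimit (liftCone F c) where
  lift s := ⟨hc.lift ((forget K).mapCone s), fun {U f} h j => by
    have (x : s.pt.carrier) : c.π.app j (hc.lift ((forget K).mapCone s) x) =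
        (s.π.app j).toFun x :=
      ConcreteCategory.congr_hom (hc.fac ((forget K).mapCone s) j) x
    simpa only [this] using (s.π.app j).map_plot h⟩
  fac s j := hom_ext fun x => ConcreteCategory.congr_hom (hc.fac ((forget K).mapCone s) j) x
  uniq s m hm := hom_ext fun x => ConcreteCategory.congr_hom
    (hc.uniq ((forget K).mapCone s) ((forget K).map m) fun j =>
      (forget K).congr_map (hm j)) x

/-- A colimit cocone of underlying sets, with the final plot structure. -/
@[simps]
def liftCocone (c : Cocone (F ⋙ forget K)) : Cocone F where
  pt := ⟨c.pt, .final F.obj fun j => c.ι.app j⟩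
  ι :=
    { app j := ⟨c.ι.app j, fun h => .of j _ h⟩
      naturality _ _ f := hom_ext fun x => ConcreteCategory.congr_hom (c.ι.naturality f) x }

/-- The cocone `liftCocone F c` is a colimit cocone if `c` is. -/
def isColimitLiftCocone {c : Cocone (F ⋙ forget K)} (hc : IsColimit c) :
    IsColimit (liftCocone F c) where
  desc s := ⟨hc.desc ((forget K).mapCocone s), fun {U f} h =>
    PlotStructure.Generated.map (q := hc.desc ((forget K).mapCocone s)) (fun j U f hf => by
      have (x : (F.obj j).carrier) : hc.desc ((forget K).mapCocone s) (c.ι.app j x) =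
          (s.ι.app j).toFun x :=
        ConcreteCategory.congr_hom (hc.fac ((forget K).mapCocone s) j) x
      simp only [this]
      exact (s.ι.app j).map_plot hf) h⟩
  fac s j := hom_ext fun x => ConcreteCategory.congr_hom (hc.fac ((forget K).mapCocone s) j) x
  uniq s m hm := hom_ext fun x => ConcreteCategory.congr_hom
    (hc.uniq ((forget K).mapCocone s) ((forget K).map m) fun j =>
      (forget K).congr_map (hm j)) x

instance : HasLimitsOfSize.{v, v} (PlotSpace K) :=
  ⟨fun _ _ => ⟨fun F => ⟨⟨_, isLimitLiftCone F (limit.isLimit _)⟩⟩⟩⟩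

instance : HasColimitsOfSize.{v, v} (PlotSpace K) :=
  ⟨fun _ _ => ⟨fun F => ⟨⟨_, isColimitLiftCocone F (colimit.isColimit _)⟩⟩⟩⟩

instance : HasFiniteLimits (PlotSpace K) := hasFiniteLimits_of_hasLimitsOfSize.{v, v} _

end Limits

end PlotSpace

end PlotSpaces

/-! ### Invariance under equivalence -/

section Equivalence

universe v₁ v₂ u₁ u₂

variable {C : Type u₁} [Category.{v₁} C] {C' : Type u₂} [Category.{v₂} C']

lemma IsCartesianClosed.of_isEquivalence (F : C ⥤ C') [F.IsEquivalence]
    (h : IsCartesianClosed C') : IsCartesianClosed C := by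
  obtain ⟨hfin, h⟩ := h
  have hC : HasFiniteProducts C := ⟨fun _ => Adjunction.hasLimitsOfShape_of_equivalence F⟩
  refine ⟨hC, fun Y => ?_⟩
  have := h (F.obj Y)
  let e : prod.functor.flip.obj Y ⋙ F ≅ F ⋙ prod.functor.flip.obj (F.obj Y) :=
    NatIso.ofComponents (fun X => PreservesLimitPair.iso F X Y) fun f => by
      have := prodComparison_natural F f (𝟙 Y)
      rw [F.map_id] at this
      exact this
  rw [← Functor.isLeftAdjoint_comp_iff_left _ F]
  exact Functor.isLeftAdjoint_of_iso e.symm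

lemma IsLocallyCartesianClosed.of_isEquivalence (F : C ⥤ C') [F.IsEquivalence]
    (h : IsLocallyCartesianClosed C') : IsLocallyCartesianClosed C := fun B =>
  (h (F.obj B)).of_isEquivalence (Over.post F)

lemma strongMono_map (F : C ⥤ C') [F.IsEquivalence] {A X : C} (i : A ⟶ X) [hi : StrongMono i] :
    StrongMono (F.map i) where
  mono := have := hi.mono; inferInstance
  rlp _ _ z _ := by
    have := hi.rlp (F.inv.map z)
    exact (F.asEquivalence.symm.toAdjunction.hasLiftingProperty_iff z i).1 this

lemma HasWeakSubobjectClassifier.of_isEquivalence [HasFiniteLimits C] [HasFiniteLimits C']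
    (F : C ⥤ C') [F.IsEquivalence]
    (h : HasWeakSubobjectClassifier C') : HasWeakSubobjectClassifier C := by
  obtain ⟨Ω, t, h⟩ := h
  obtain ⟨Ω, ⟨e⟩⟩ : ∃ Ω₀, Nonempty (F.obj Ω₀ ≅ Ω) := ⟨_, ⟨F.objObjPreimageIso Ω⟩⟩
  let τ : F.obj (⊤_ C) ≅ ⊤_ C' := PreservesTerminal.iso F
  -- `F` preserves `⊤_` and hits `Ω` only up to isomorphism, hence the conjugation by `τ` and `e`.
  refine ⟨_, F.preimage (τ.hom ≫ t ≫ e.inv), fun A X i hi => ?_⟩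
  have key (χ : X ⟶ Ω) : IsPullback i (terminal.from A) χ (F.preimage (τ.hom ≫ t ≫ e.inv)) ↔
      IsPullback (F.map i) (terminal.from (F.obj A)) (F.map χ ≫ e.hom) t := by
    constructor
    · intro H
      exact (H.map F).of_iso (Iso.refl _) (Iso.refl _) τ e (by simp) (Subsingleton.elim _ _) (by simp)
        (by simp)
    · intro H
      refine IsPullback.of_map F (F.map_injective ?_) ?_
      · have hτ : F.map (terminal.from A) ≫ τ.hom = terminal.from _ := Subsingleton.elim _ _
        simp [← cancel_mono e.hom, reassoc_of% hτ, H.w]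
      exact H.of_iso (Iso.refl _) (Iso.refl _) τ.symm e.symm (by simp)
        (by rw [← cancel_mono τ.hom]; exact Subsingleton.elim _ _) (by simp)
        (by simp)
  obtain ⟨χ, hχ, huniq⟩ := h (F.map i) (strongMono_map F i)
  refine ⟨F.preimage (χ ≫ e.inv), (key _).2 (by simpa using hχ), fun χ' hχ' => ?_⟩
  apply F.map_injective
  rw [← huniq _ ((key _).1 hχ')]
  simp

lemma IsQuasitopos.of_isEquivalence (F : C ⥤ C') [F.IsEquivalence] (h : IsQuasitopos C') :
    IsQuasitopos C := by
  obtain ⟨h₁, h₂, h₃, h₄⟩ := h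
  have : HasFiniteLimits C := ⟨fun _ _ _ => Adjunction.hasLimitsOfShape_of_equivalence F⟩
  exact ⟨h₁.of_isEquivalence F, this,
    ⟨fun _ _ _ => Adjunction.hasColimitsOfShape_of_equivalence F⟩, h₄.of_isEquivalence F⟩

end Equivalence

namespace PlotSpace

/-! ### Exponentials in slices -/

section LocallyCartesianClosed

variable {D : Type u} [Category.{v} D] [HasTerminal D] {K : Coverage D} {B : PlotSpace K}

@[simp] lemma over_hom_toFun {X Y : Over B} (f : X ⟶ Y) (x : X.left.carrier) :
    Y.hom.toFun (f.left.toFun x) = X.hom.toFun x :=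
  congr_toFun (Over.w f) x

/-- The fibre product of two spaces over `B`. -/
@[simps]
def fiberProd (X Y : Over B) : PlotSpace K where
  carrier := {z : X.left.carrier × Y.left.carrier // X.hom.toFun z.1 = Y.hom.toFun z.2}
  plots :=
    { IsPlot f := X.left.IsPlot (fun d => (f d).1.1) ∧ Y.left.IsPlot (fun d => (f d).1.2)
      point _ := ⟨X.left.plots.point _, Y.left.plots.point _⟩
      comp h g := ⟨X.left.plots.comp h.1 g, Y.left.plots.comp h.2 g⟩
      glue R hR _ h := ⟨X.left.plots.glue R hR _ fun V g hg => (h V g hg).1,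
        Y.left.plots.glue R hR _ fun V g hg => (h V g hg).2⟩ }

/-- The product with `Y` in the slice over `B`, on underlying sets the fibre product. -/
@[simps]
def overProd (Y : Over B) : Over B ⥤ Over B where
  obj X := Over.mk (Y := fiberProd X Y) ⟨fun z => X.hom.toFun z.1.1, fun h => X.hom.map_plot h.1⟩
  map {X X'} f := Over.homMk (U := Over.mk (Y := fiberProd X Y) _)
    (V := Over.mk (Y := fiberProd X' Y) _)
    ⟨fun z => ⟨(f.left.toFun z.1.1, z.1.2), by simpa using z.2⟩,
      fun h => ⟨f.left.map_plot h.1, h.2⟩⟩ (hom_ext fun z => over_hom_toFun f z.1.1)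

/-- The two projections from the fibre product. -/
def overProdFan (X Y : Over B) : BinaryFan X Y :=
  BinaryFan.mk (P := (overProd Y).obj X)
    (Over.homMk ⟨fun z => z.1.1, fun h => h.1⟩)
    (Over.homMk ⟨fun z => z.1.2, fun h => h.2⟩ (hom_ext fun z => z.2.symm))

/-- The fibre product is a product in the slice category. -/
def isLimitOverProdFan (X Y : Over B) : IsLimit (overProdFan X Y) :=
  BinaryFan.IsLimit.mk _
    (fun f g => Over.homMk ⟨fun w => ⟨(f.left.toFun w, g.left.toFun w), by simp⟩,
        fun h => ⟨f.left.map_plot h, g.left.map_plot h⟩⟩ (hom_ext fun w => over_hom_toFun f w))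
    (fun f g => rfl) (fun f g => rfl)
    (fun f g m hf hg => by
      subst hf hg
      rfl)

/-- A morphism from the fibre of `Y` over a point of `B` to the fibre of `Z`. -/
structure FiberMap (Y Z : Over B) where
  /-- The point of the base. -/
  base : B.carrier
  /-- The function between the fibres. -/
  toFun : ∀ y : Y.left.carrier, Y.hom.toFun y = base → Z.left.carrier
  map_base : ∀ (y : Y.left.carrier) (h : Y.hom.toFun y = base), Z.hom.toFun (toFun y h) = base
  -- Exactly what makes constant functions plots of the exponential.
  map_plot : ∀ {U : D} (y : (⊤_ D ⟶ U) → Y.left.carrier) (_ : Y.left.IsPlot y)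
    (h : ∀ d, Y.hom.toFun (y d) = base), Z.left.IsPlot (fun d => toFun (y d) (h d))

lemma FiberMap.ext_of_forall {Y Z : Over B} {φ ψ : FiberMap Y Z} (hb : φ.base = ψ.base)
    (h : ∀ y hφ hψ, φ.toFun y hφ = ψ.toFun y hψ) : φ = ψ := by
  obtain ⟨b, φ, _, _⟩ := φ
  obtain ⟨_, ψ, _, _⟩ := ψ
  obtain rfl : b = _ := hb
  obtain rfl : φ = ψ := funext fun y => funext fun hy => h y hy hy
  rfl

/-- The space of fibrewise maps from `Y` to `Z`. -/
@[simps]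
def fiberExp (Y Z : Over B) : PlotSpace K where
  carrier := FiberMap Y Z
  plots :=
    -- Quantifying over all `g` forces stability under precomposition; `g = 𝟙 U` makes evaluation a
    -- morphism.
    { IsPlot {U} f := B.IsPlot (fun d => (f d).base) ∧
        ∀ {V : D} (g : V ⟶ U) (y : (⊤_ D ⟶ V) → Y.left.carrier) (_ : Y.left.IsPlot y)
          (h : ∀ d, Y.hom.toFun (y d) = (f (d ≫ g)).base),
          Z.left.IsPlot (fun d => (f (d ≫ g)).toFun (y d) (h d))
      point f := by
        obtain ⟨φ, rfl⟩ : ∃ φ, f = fun _ => φ :=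
          ⟨f (𝟙 _), funext fun d => congrArg f (Subsingleton.elim _ _)⟩
        exact ⟨isPlot_const B _ _, fun _ y hy h => φ.map_plot y hy h⟩
      comp {U V f} hf g := ⟨B.plots.comp hf.1 g, fun {W} k y hy h => by
        simpa only [Category.assoc] using
          hf.2 (k ≫ g) y hy (by simpa only [Category.assoc] using h)⟩
      glue {U} R hR f hf := by
        refine ⟨B.plots.glue R hR _ fun V g hg => (hf V g hg).1, fun {V} g y hy h => ?_⟩
        obtain ⟨R', hR', hfac⟩ := K.pullback g R hR
        refine Z.left.plots.glue R' hR' _ fun W k hk => ?_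
        obtain ⟨V', i, e, he, hcomm⟩ := hfac hk
        have := (hf V' e he).2 i (fun d => y (d ≫ k)) (Y.left.plots.comp hy k) fun d => by
          rw [h]
          simp only [Category.assoc, hcomm]
        simpa only [Category.assoc, hcomm] using this }

/-- The exponential in the slice over `B`. -/
@[simps!]
def overExp (Y Z : Over B) : Over B :=
  Over.mk (Y := fiberExp Y Z) ⟨fun φ => φ.base, fun h => h.1⟩

/-- Currying over `B`. -/
def overExpEquiv (X Y Z : Over B) : ((overProd Y).obj X ⟶ Z) ≃ (X ⟶ overExp Y Z) where
  toFun φ := Over.homMk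
    ⟨fun x =>
      { base := X.hom.toFun x
        toFun y h := φ.left.toFun ⟨(x, y), h.symm⟩
        map_base y h := over_hom_toFun φ ⟨(x, y), h.symm⟩
        map_plot y hy h := φ.left.map_plot (f := fun d => ⟨(x, y d), (h d).symm⟩)
          ⟨isPlot_const _ _ _, hy⟩ },
      fun {U f} hf => ⟨X.hom.map_plot hf, fun g y hy h => φ.left.map_plot
        (f := fun d => ⟨(f (d ≫ g), y d), (h d).symm⟩) ⟨X.left.plots.comp hf g, hy⟩⟩⟩
  invFun ψ := Over.homMk
    ⟨fun z => FiberMap.toFun (ψ.left.toFun z.1.1) z.1.2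
        (z.2.symm.trans (over_hom_toFun ψ z.1.1).symm),
      fun {U f} hf => by
        have := (ψ.left.map_plot hf.1).2 (𝟙 U) (fun d => (f d).1.2) hf.2 fun d => by
          rw [Category.comp_id]
          exact (f d).2.symm.trans (over_hom_toFun ψ _).symm
        simpa only [Category.comp_id] using this⟩
    (hom_ext fun z => (FiberMap.map_base (ψ.left.toFun z.1.1) z.1.2 _).trans
      (over_hom_toFun ψ z.1.1))
  left_inv φ := rfl
  right_inv ψ := by
    ext1
    exact hom_ext fun x => FiberMap.ext_of_forall (over_hom_toFun ψ x).symm fun _ _ _ => rfl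

/-- The functor `overProd Y` has a right adjoint. -/
lemma isLeftAdjoint_overProd (Y : Over B) : (overProd Y).IsLeftAdjoint :=
  (Adjunction.adjunctionOfEquivRight (fun X Z => overExpEquiv X Y Z)
    fun _ _ _ f _ => by
      ext1
      exact hom_ext fun x => FiberMap.ext_of_forall (over_hom_toFun f x).symm
        fun _ _ _ => rfl).isLeftAdjoint

variable (K) in
lemma isLocallyCartesianClosed : IsLocallyCartesianClosed (PlotSpace K) := fun B => by
  have : HasFiniteProducts (Over B) :=
    Over.ConstructProducts.over_finiteProducts_of_finiteWidePullbacks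
  refine ⟨this, fun Y => ?_⟩
  have := isLeftAdjoint_overProd Y
  let c (X : Over B) : (overProd Y).obj X ≅ X ⨯ Y :=
    (isLimitOverProdFan X Y).conePointUniqueUpToIso (limit.isLimit (pair X Y))
  have fst (X : Over B) : (c X).hom ≫ prod.fst = (overProdFan X Y).fst :=
    (isLimitOverProdFan X Y).conePointUniqueUpToIso_hom_comp _ ⟨WalkingPair.left⟩
  have snd (X : Over B) : (c X).hom ≫ prod.snd = (overProdFan X Y).snd :=
    (isLimitOverProdFan X Y).conePointUniqueUpToIso_hom_comp _ ⟨WalkingPair.right⟩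
  let e : overProd Y ≅ prod.functor.flip.obj Y :=
    NatIso.ofComponents c fun {X X'} f => by
      change _ ≫ (c X').hom = (c X).hom ≫ prod.map f (𝟙 Y)
      apply Limits.prod.hom_ext
      · rw [Category.assoc, Category.assoc, prod.map_fst, fst, reassoc_of% fst]
        rfl
      · rw [Category.assoc, Category.assoc, prod.map_snd, snd, reassoc_of% snd]
        rfl
  exact Functor.isLeftAdjoint_of_iso e

end LocallyCartesianClosed

/-! ### The weak subobject classifier -/

section Classifier

variable {D : Type u} [Category.{v} D] [HasTerminal D] {K : Coverage D}

lemma epi_of_surjective {S T : PlotSpace K} (f : S ⟶ T) (h : Function.Surjective f.toFun) :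
    Epi f where
  left_cancellation g k hgk := hom_ext fun y => by
    obtain ⟨x, rfl⟩ := h y
    exact congr_toFun hgk x

/-- A set with all functions as plots. -/
@[simps]
def codiscrete (K : Coverage D) (S : Type v) : PlotSpace K where
  carrier := S
  plots :=
    { IsPlot _ := True
      point _ := trivial
      comp _ _ := trivial
      glue _ _ _ _ := trivial }

/-- Every function to a codiscrete space is a morphism. -/
def toCodiscrete {S : PlotSpace K} {T : Type v} (f : S.carrier → T) : S ⟶ codiscrete K T :=
  ⟨f, fun _ => trivial⟩

/-- The image of a morphism, with the subspace structure. -/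
def image {A X : PlotSpace K} (i : A ⟶ X) : PlotSpace K where
  carrier := Set.range i.toFun
  plots := .initial (fun _ : Unit => X) fun _ => Subtype.val

/-- A strong monomorphism is injective and its source carries the subspace structure. -/
lemma isEmbedding_of_strongMono {A X : PlotSpace K} (i : A ⟶ X) [hi : StrongMono i] :
    Function.Injective i.toFun ∧ ∀ {U : D} (f : (⊤_ D ⟶ U) → A.carrier),
      X.IsPlot (fun d => i.toFun (f d)) → A.IsPlot f := by
  let p : A ⟶ image i := ⟨Set.rangeFactorization i.toFun, fun h _ => i.map_plot h⟩
  let j : image i ⟶ X := ⟨Subtype.val, fun h => h ()⟩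
  have : Epi p := epi_of_surjective p Set.rangeFactorization_surjective
  have := hi.rlp p
  -- The lift is a morphism `image i ⟶ A` retracting `p`: it yields injectivity and carries plots of
  -- the image back to plots of `A`.
  have sq : CommSq (𝟙 A) p i j := ⟨rfl⟩
  have hl (x : A.carrier) : sq.lift.toFun (p.toFun x) = x := congr_toFun sq.fac_left x
  refine ⟨fun x y hxy => ?_, fun f hf => ?_⟩
  · rw [← hl x, ← hl y]
    exact congrArg sq.lift.toFun (Subtype.ext hxy)
  · simpa only [hl] using sq.lift.map_plot (f := fun d => p.toFun (f d)) fun _ => hf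

variable (K) in
lemma hasWeakSubobjectClassifier : HasWeakSubobjectClassifier (PlotSpace K) := by
  let T : ⊤_ (PlotSpace K) ⟶ codiscrete K (ULift.{v} Prop) := toCodiscrete fun _ => ⟨True⟩
  refine ⟨_, T, fun A X i hi => ?_⟩
  obtain ⟨hinj, hplot⟩ := isEmbedding_of_strongMono i
  let one : PlotSpace K := codiscrete K PUnit
  let χ₀ : X ⟶ codiscrete K (ULift.{v} Prop) := toCodiscrete fun x => ⟨x ∈ Set.range i.toFun⟩
  refine ⟨χ₀, ?_, fun χ hχ => ?_⟩
  · have hs (s : PullbackCone χ₀ T) (x : s.pt.carrier) :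
        s.fst.toFun x ∈ Set.range i.toFun :=
      of_eq_true (congrArg ULift.down (congr_toFun s.condition x))
    refine ⟨⟨hom_ext fun a => ULift.ext _ _ (eq_true ⟨a, rfl⟩)⟩,
      ⟨PullbackCone.IsLimit.mk _ ?_ ?_ ?_ ?_⟩⟩
    · intro s
      exact ⟨fun x => (hs s x).choose, fun h => hplot _ (by
        simpa only [fun x => (hs s x).choose_spec] using s.fst.map_plot h)⟩
    · intro s
      exact hom_ext fun x => (hs s x).choose_spec
    · exact fun s => Subsingleton.elim _ _
    · intro s m hm _
      exact hom_ext fun x => hinj ((congr_toFun hm x).trans (hs s x).choose_spec.symm)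
  -- Uniqueness is tested on points: if `χ` is true at `x`, then `x`, viewed as a morphism from
  -- `one`, factors through the pullback `A`.
  · refine hom_ext fun x => ULift.ext _ _ (propext ⟨fun h => ?_, ?_⟩)
    · let f : one ⟶ X := ⟨fun _ => x, fun _ => isPlot_const X _ x⟩
      have hf : f ≫ χ = terminal.from one ≫ T :=
        hom_ext fun _ => ULift.ext _ _ (eq_true h)
      exact ⟨(hχ.lift f _ hf).toFun ⟨⟩, congr_toFun (hχ.lift_fst f _ hf) ⟨⟩⟩
    · rintro ⟨a, rfl⟩
      exact of_eq_true (congrArg ULift.down (congr_toFun hχ.w a))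

end Classifier

/-! ### Plot spaces are concrete sheaves -/

section Equivalence

variable {D : Type u} [Category.{v} D] [HasTerminal D] {K : Coverage D}

/-- The presheaf of plots of a plot space. -/
noncomputable def plotPresheaf (S : PlotSpace K) : Dᵒᵖ ⥤ Type v where
  obj U := {f : (⊤_ D ⟶ U.unop) → S.carrier // S.IsPlot f}
  map g := ↾fun f => ⟨fun d => f.1 (d ≫ g.unop), S.plots.comp f.2 g.unop⟩

@[simp] lemma plotPresheaf_map_val (S : PlotSpace K) {U V : D} (g : V ⟶ U)
    (f : S.plotPresheaf.obj (op U)) (d : ⊤_ D ⟶ V) :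
    (S.plotPresheaf.map g.op f).1 d = f.1 (d ≫ g) := rfl

/-- The functor sending a plot space to its presheaf of plots. -/
noncomputable def toPresheaf (K : Coverage D) : PlotSpace K ⥤ Dᵒᵖ ⥤ Type v where
  obj S := S.plotPresheaf
  map φ := { app _ := ↾fun f => ⟨fun d => φ.toFun (f.1 d), φ.map_plot f.2⟩ }

lemma isConcrete_plotPresheaf (S : PlotSpace K) : IsConcrete S.plotPresheaf := by
  intro U f f' h
  refine Subtype.ext (funext fun d => ?_)
  have := congrFun (congrArg Subtype.val (congrFun h d)) (𝟙 _)
  simpa [underlying] using this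

lemma isSheaf_plotPresheaf (hK : IsConcreteSite K) (S : PlotSpace K) :
    IsSheaf K S.plotPresheaf := by
  intro U R hR x hx
  -- Each point `p` is lifted to some member of the cover; by `key`, compatibility over the test
  -- object `1` makes the glued value independent of this lift.
  choose V f hf q hq using hK.jointly_surjective R hR
  have key {W : D} (g : W ⟶ U) (hg : R g) (d : ⊤_ D ⟶ W) :
      (x (f (d ≫ g)) (hf _)).1 (q (d ≫ g)) = (x g hg).1 d := by
    have := congrFun (congrArg Subtype.val (hx (q (d ≫ g)) d (hf _) hg (hq _))) (𝟙 _)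
    simpa using this
  refine ⟨⟨fun p => (x (f p) (hf p)).1 (q p), ?_⟩, fun W g hg => Subtype.ext (funext (key g hg)),
    fun t ht => Subtype.ext (funext fun p => ?_)⟩
  · refine S.plots.glue R hR _ fun W g hg => ?_
    simpa only [key g hg] using (x g hg).2
  · have := congrFun (congrArg Subtype.val (ht (f p) (hf p))) (q p)
    simpa [hq] using this

/-- The functor sending a plot space to its concrete sheaf of plots. -/
noncomputable def toDSpace (hK : IsConcreteSite K) : PlotSpace K ⥤ DSpace K :=
  (isConcreteSheaf K).lift (toPresheaf K) fun S =>
    ⟨isSheaf_plotPresheaf hK S, isConcrete_plotPresheaf S⟩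

/-- The point of the presheaf of plots given by a point of the space. -/
noncomputable def pointPlot (S : PlotSpace K) (s : S.carrier) : S.plotPresheaf.obj (op (⊤_ D)) :=
  ⟨fun _ => s, S.plots.point _⟩

instance : (toPresheaf K).Faithful where
  map_injective {S T φ ψ} h := hom_ext fun s =>
    congrFun (congrArg Subtype.val (ConcreteCategory.congr_hom
      (NatTrans.congr_app h (op (⊤_ D))) (S.pointPlot s) :
        (((toPresheaf K).map φ).app (op (⊤_ D)) (S.pointPlot s) : T.plotPresheaf.obj _) =
          ((toPresheaf K).map ψ).app (op (⊤_ D)) (S.pointPlot s))) (𝟙 _)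

/-- Naturality along points `1 ⟶ U` shows that `α` is determined by its action on points; this is
what gives fullness. -/
lemma app_apply {S T : PlotSpace K} (α : S.plotPresheaf ⟶ T.plotPresheaf) {U : D}
    (f : S.plotPresheaf.obj (op U)) (d : ⊤_ D ⟶ U) :
    (α.app (op U) f).1 d = (α.app (op (⊤_ D)) (S.pointPlot (f.1 d))).1 (𝟙 _) := by
  have h := congrFun (congrArg Subtype.val
    (ConcreteCategory.congr_hom (α.naturality d.op) f)) (𝟙 _)
  have h' : S.plotPresheaf.map d.op f = S.pointPlot (f.1 d) :=
    Subtype.ext (funext fun e => congrArg f.1 (by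
      rw [Subsingleton.elim e (𝟙 _)]; exact Category.id_comp d))
  simp only [comp_apply, h'] at h
  rw [h]
  exact congrArg _ (Category.id_comp d).symm

instance : (toPresheaf K).Full where
  map_surjective {S T} α := ⟨⟨fun s => (α.app (op (⊤_ D)) (S.pointPlot s)).1 (𝟙 _),
      fun {U f} hf => by
        exact (congrArg (fun k => T.IsPlot k) (funext (app_apply α (U := U) ⟨f, hf⟩))).mp
          (α.app (op U) ⟨f, hf⟩).2⟩, by
    ext U f
    exact Subtype.ext (funext fun d => (app_apply α f d).symm)⟩

/-- The plot space underlying a concrete sheaf. -/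
def ofDSpace (hK : IsConcreteSite K) (X : DSpace K) : PlotSpace K where
  carrier := X.obj.obj (op (⊤_ D))
  plots :=
    { IsPlot f := f ∈ Set.range (underlying X.obj)
      point f := ⟨f (𝟙 _), funext fun d => by
        rw [Subsingleton.elim d (𝟙 _)]; simp [underlying]⟩
      comp := by
        rintro U V _ ⟨φ, rfl⟩ g
        exact ⟨X.obj.map g.op φ, funext fun d => by simp [underlying]⟩
      glue {U} R hR f h := by
        choose φ hφ using h
        have hφ' {V W : D} (g : V ⟶ U) (hg : R g) (k : W ⟶ V) (d : ⊤_ D ⟶ W) :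
            X.obj.map d.op (X.obj.map k.op (φ V g hg)) = f (d ≫ k ≫ g) := by
          simpa [underlying] using congrFun (hφ V g hg) (d ≫ k)
        -- Both restrictions to an overlap have the same underlying function, a restriction of `f`,
        -- so concreteness makes the plots compatible.
        obtain ⟨t, ht, -⟩ := X.property.1 R hR (fun V g hg => φ V g hg)
          fun V₁ V₂ W g₁ g₂ f₁ f₂ h₁ h₂ hcomm => X.property.2 W (funext fun d => by
            simp only [underlying, hφ', hcomm])
        refine ⟨t, funext fun p => ?_⟩
        obtain ⟨V, g, hg, q, rfl⟩ := hK.jointly_surjective R hR p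
        have : X.obj.map g.op t = φ V g hg := ht g hg
        rw [← congrFun (hφ V g hg) q, ← this]
        simp [underlying] }

/-- Concreteness identifies `X(U)` with the image of `underlying`, which is by definition the set of
plots of `ofDSpace hK X`. -/
lemma essSurj_toDSpace (hK : IsConcreteSite K) : (toDSpace hK).EssSurj where
  mem_essImage X := ⟨ofDSpace hK X, ⟨(isConcreteSheaf K).isoMk
    (NatIso.ofComponents (fun U => (Equiv.ofInjective _ (X.property.2 U.unop)).toIso)
      fun {U V} g => by
        ext φ
        refine Subtype.ext (funext fun d => ?_)
        change X.obj.map d.op (X.obj.map g φ) = X.obj.map (d ≫ g.unop).op φ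
        simp).symm⟩⟩

lemma isEquivalence_toDSpace (hK : IsConcreteSite K) : (toDSpace hK).IsEquivalence where
  faithful := Functor.Faithful.of_comp_iso ((isConcreteSheaf K).liftCompιIso (toPresheaf K) _)
  full := Functor.Full.of_comp_faithful_iso ((isConcreteSheaf K).liftCompιIso (toPresheaf K) _)
  essSurj := essSurj_toDSpace hK

variable (K) in
lemma isQuasitopos : IsQuasitopos (PlotSpace K) where
  locallyCartesianClosed := isLocallyCartesianClosed K
  hasFiniteLimits := inferInstance
  hasFiniteColimits := hasFiniteColimits_of_hasColimitsOfSize.{v, v} _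
  hasWeakSubobjectClassifier := hasWeakSubobjectClassifier K

end Equivalence

end PlotSpace

end GeneralizedSpaces

theorem theorem4 {D : Type u} [Category.{v} D] [HasTerminal D] (K : Coverage D)
    (hK : GeneralizedSpaces.IsConcreteSite K) :
    GeneralizedSpaces.IsQuasitopos (GeneralizedSpaces.DSpace K) ∧
      HasLimitsOfSize.{v, v} (GeneralizedSpaces.DSpace K) ∧
      HasColimitsOfSize.{v, v} (GeneralizedSpaces.DSpace K) := by
  have := GeneralizedSpaces.PlotSpace.isEquivalence_toDSpace hK
  let F := (GeneralizedSpaces.PlotSpace.toDSpace hK).inv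
  exact ⟨(GeneralizedSpaces.PlotSpace.isQuasitopos K).of_isEquivalence F,
    Adjunction.has_limits_of_equivalence F, Adjunction.has_colimits_of_equivalence F⟩
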